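/- Let $\mathrm{PG}(d,\mathbb{R})$ denote the $d$-dimensional real projective space. For a finite set $S$ of points of $\mathrm{PG}(d,\mathbb{R})$, call a hyperplane $\pi$ \emph{ordinary} if $|\pi\cap S|=d$. Let $e_d(n)$ be the minimal number of ordinary hyperplanes of $S$, where the minimum is taken over all sets $S$ of $n$ points of $\mathrm{PG}(d,\mathbb{R})$ such that any $d$ points of $S$ span a hyperplane and $S$ is not contained in a hyperplane. Then $$e_3(9)\geq 14.$$ -/

import Mathlib

open scoped LinearAlgebra.Projectivization

namespace OrdinaryHyperplanes

/-- The real projective space `PG(d, ℝ)`: points are the lines through the origin of `ℝ^(d+1)`. -/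
abbrev PG (d : ℕ) : Type := ℙ ℝ (Fin (d + 1) → ℝ)

/-- Projective subspaces of `PG(d, ℝ)`. -/
abbrev PGSubspace (d : ℕ) : Type := Projectivization.Subspace ℝ (Fin (d + 1) → ℝ)

/-- A hyperplane of `PG(d, ℝ)` is a projective subspace of projective dimension `d - 1`, that is,
one whose underlying linear subspace of `ℝ^(d+1)` has dimension `d`. -/
def IsHyperplane {d : ℕ} (H : PGSubspace d) : Prop :=
  Module.finrank ℝ (Projectivization.Subspace.submodule H) = d

/-- Any `d` (distinct) points of `S` span a hyperplane, and no hyperplane contains all the points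
of `S`. -/
def IsAdmissible {d : ℕ} (S : Finset (PG d)) : Prop :=
  (∀ T : Finset (PG d), T ⊆ S → T.card = d →
    IsHyperplane (Projectivization.Subspace.span (T : Set (PG d)))) ∧
  ¬ ∃ H : PGSubspace d, IsHyperplane H ∧ (S : Set (PG d)) ⊆ (H : Set (PG d))

/-- The ordinary hyperplanes of `S`: those meeting `S` in precisely `d` points. -/
def ordinaryHyperplanes {d : ℕ} (S : Finset (PG d)) : Set (PGSubspace d) :=
  {H | IsHyperplane H ∧ ((S : Set (PG d)) ∩ (H : Set (PG d))).ncard = d}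

/-- `e d n` is the minimal number of ordinary hyperplanes of `S`, over all sets `S` of `n` points of
`PG(d, ℝ)` such that any `d` points of `S` span a hyperplane and `S` is not contained in a
hyperplane. -/
noncomputable def e (d n : ℕ) : ℕ :=
  sInf {N : ℕ | ∃ S : Finset (PG d),
    S.card = n ∧ IsAdmissible S ∧ (ordinaryHyperplanes S).ncard = N}

end OrdinaryHyperplanes

/-!
Fix an admissible set `S` of nine points of `PG(3, ℝ)`. The sections of `S` by the planes spanned by
three of its points are blocks such that any three points of `S` lie in exactly one block
(`IsWiseBalanced 3`), and the ordinary planes correspond to the blocks of size three. Removing a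
point `p` from the blocks through it (projecting from `p`) gives a linear space on eight points;
write `t k p` for its number of lines of size `k`, and `N k` for the number of blocks of size `k`.
Double counting gives `∑ p, t k p = (k + 1) * N (k + 1)`.

The heart of the argument is `IsWiseBalanced.four_le_blockCount_two`: a linear space on eight
points that is neither a single line nor the Möbius–Kantor configuration has at least four lines of
size two, and if it has exactly four then it has exactly one line of size four and none longer.
For a line `l` and a point `x` off it, the lines joining `x` to `l` use up the remaining points, so
that many of them are ordinary when `l` is long; this settles the case of a line with at least four
points. If all lines have at most three points, each point lies on an odd number of ordinary lines
because it has seven others to be joined to, so there are at least four ordinary lines; equality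
forces each point to lie on exactly one, and this leaves only the Möbius–Kantor configuration. Its
coordinates involve a root of `u² + u + 1`, so it does not occur over `ℝ`
(`false_of_isCombination`).

Hence `3 * N 3 ≥ 36`. If `N 3 = 12`, every point lies on exactly one block of size five, so that
`9 = 5 * N 5`, which is absurd. If `N 3 = 13`, then `∑ B, (#B).choose 3 = 84` shows that some block
has a size other than `3` for which the binomial coefficient is odd, namely seven; each of its
points then has `t 2 p ≥ 5`, and `3 * N 3 ≥ 7 * 5 + 2 * 4 = 43`, again absurd.

The minimum defining `e 3 9` is over a nonempty set because nine points on the twisted cubic are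
admissible; without this the infimum would be the junk value `0`.
-/

namespace OrdinaryHyperplanes

open Finset

/-! ### Balanced families of blocks and their derived families -/

section Designs

variable {α : Type*} {t : ℕ} {X Y l m : Finset α} {L : Finset (Finset α)} {x y z : α}

/-- `L` is a family of blocks in `X`, of arbitrary sizes at least `t`, such that each `t`-subset of
`X` lies in exactly one block. For `t = 1` these are partitions, for `t = 2` linear spaces. -/
def IsWiseBalanced (t : ℕ) (X : Finset α) (L : Finset (Finset α)) : Prop :=
  (∀ l ∈ L, l ⊆ X ∧ t ≤ #l) ∧ ∀ T ⊆ X, #T = t → ∃! l, l ∈ L ∧ T ⊆ l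

/-- The number of blocks of size `k`. -/
def blockCount (k : ℕ) (L : Finset (Finset α)) : ℕ := #{l ∈ L | #l = k}

/-- `x`, `y`, `z` are three distinct points on a common block of `L`. -/
def Collinear (L : Finset (Finset α)) (x y z : α) : Prop :=
  (x ≠ y ∧ y ≠ z ∧ x ≠ z) ∧ ∃ l ∈ L, x ∈ l ∧ y ∈ l ∧ z ∈ l

theorem IsWiseBalanced.eq_of_subset (h : IsWiseBalanced t X L) {T : Finset α} (hT : #T = t)
    (hl : l ∈ L) (hm : m ∈ L) (hTl : T ⊆ l) (hTm : T ⊆ m) : l = m :=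
  (h.2 T (hTl.trans (h.1 l hl).1) hT).unique ⟨hl, hTl⟩ ⟨hm, hTm⟩

theorem Collinear.swap (h : Collinear L x y z) : Collinear L y x z := by
  obtain ⟨⟨h1, h2, h3⟩, l, hl, hx, hy, hz⟩ := h
  exact ⟨⟨h1.symm, h3, h2⟩, l, hl, hy, hx, hz⟩

theorem Collinear.rotate (h : Collinear L x y z) : Collinear L y z x := by
  obtain ⟨⟨h1, h2, h3⟩, l, hl, hx, hy, hz⟩ := h
  exact ⟨⟨h2, h3.symm, h1.symm⟩, l, hl, hy, hz, hx⟩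

variable [DecidableEq α]

/-- The derived family at `x`: the blocks through `x`, with `x` removed. -/
def derived (x : α) (L : Finset (Finset α)) : Finset (Finset α) :=
  {l ∈ L | x ∈ l}.image (·.erase x)

theorem IsWiseBalanced.card_inter_lt (h : IsWiseBalanced t X L)
    (hl : l ∈ L) (hm : m ∈ L) (hlm : l ≠ m) : #(l ∩ m) < t := by
  by_contra! hc
  obtain ⟨T, hT, hTc⟩ := exists_subset_card_eq hc
  exact hlm (h.eq_of_subset hTc hl hm (hT.trans inter_subset_left) (hT.trans inter_subset_right))

theorem IsWiseBalanced.sum_choose (h : IsWiseBalanced t X L) :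
    ∑ l ∈ L, (#l).choose t = (#X).choose t := by
  have hX : powersetCard t X = L.biUnion (powersetCard t) := by
    ext T
    simp only [mem_powersetCard, mem_biUnion]
    constructor
    · rintro ⟨hT, hc⟩
      obtain ⟨l, ⟨hl, hTl⟩, -⟩ := h.2 T hT hc
      exact ⟨l, hl, hTl, hc⟩
    · rintro ⟨l, hl, hTl, hc⟩
      exact ⟨hTl.trans (h.1 l hl).1, hc⟩
  rw [← card_powersetCard, hX, card_biUnion]
  · simp
  · intro l hl m hm hlm
    rw [Function.onFun, disjoint_left]
    intro T hTl hTm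
    rw [mem_powersetCard] at hTl hTm
    exact hlm (h.eq_of_subset hTl.2 hl hm hTl.1 hTm.1)

theorem mem_derived : m ∈ derived x L ↔ x ∉ m ∧ insert x m ∈ L := by
  simp only [derived, mem_image, mem_filter]
  constructor
  · rintro ⟨l, ⟨hl, hx⟩, rfl⟩
    exact ⟨notMem_erase x l, by rwa [insert_erase hx]⟩
  · rintro ⟨hx, hm⟩
    exact ⟨insert x m, ⟨hm, mem_insert_self x m⟩, erase_insert hx⟩

theorem erase_mem_derived (hl : l ∈ L) (hx : x ∈ l) : l.erase x ∈ derived x L :=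
  mem_derived.2 ⟨notMem_erase x l, by rwa [insert_erase hx]⟩

theorem IsWiseBalanced.isWiseBalanced_derived (h : IsWiseBalanced (t + 1) X L) (hx : x ∈ X) :
    IsWiseBalanced t (X.erase x) (derived x L) := by
  constructor
  · intro m hm
    obtain ⟨hxm, hm⟩ := mem_derived.1 hm
    obtain ⟨h1, h2⟩ := h.1 _ hm
    rw [card_insert_of_notMem hxm] at h2
    exact ⟨subset_erase.2 ⟨(subset_insert x m).trans h1, hxm⟩, by omega⟩
  · intro T hT hTc
    obtain ⟨hTX, hxT⟩ := subset_erase.1 hT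
    obtain ⟨l, ⟨hl, hTl⟩, hu⟩ := h.2 (insert x T) (insert_subset hx hTX)
      (by rw [card_insert_of_notMem hxT, hTc])
    have hxl : x ∈ l := hTl (mem_insert_self x T)
    refine ⟨l.erase x, ⟨erase_mem_derived hl hxl,
      subset_erase.2 ⟨(subset_insert x T).trans hTl, hxT⟩⟩, ?_⟩
    rintro m ⟨hm, hTm⟩
    obtain ⟨hxm, hm⟩ := mem_derived.1 hm
    rw [← hu _ ⟨hm, insert_subset_insert x hTm⟩, erase_insert hxm]

/-- The blocks of the derived family correspond to the blocks through `x`; `p` and `q` express the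
same property before and after putting `x` back. -/
theorem card_filter_derived (p q : Finset α → Prop) [DecidablePred p] [DecidablePred q]
    (hpq : ∀ m, x ∉ m → (p m ↔ q (insert x m))) :
    #{m ∈ derived x L | p m} = #{l ∈ L | x ∈ l ∧ q l} := by
  symm
  refine card_nbij' (·.erase x) (insert x ·) ?_ ?_ ?_ ?_
  · intro l hl
    simp only [mem_coe, mem_filter] at hl ⊢
    refine ⟨erase_mem_derived hl.1 hl.2.1, ?_⟩
    rw [hpq _ (notMem_erase x l), insert_erase hl.2.1]
    exact hl.2.2
  · intro m hm
    simp only [mem_coe, mem_filter, mem_derived] at hm ⊢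
    exact ⟨hm.1.2, mem_insert_self x m, (hpq m hm.1.1).1 hm.2⟩
  · intro l hl
    simp only [mem_coe, mem_filter] at hl
    exact insert_erase hl.2.1
  · intro m hm
    simp only [mem_coe, mem_filter, mem_derived] at hm
    exact erase_insert hm.1.1

theorem blockCount_derived (k : ℕ) (x : α) (L : Finset (Finset α)) :
    blockCount k (derived x L) = #{l ∈ L | x ∈ l ∧ #l = k + 1} :=
  card_filter_derived _ _ fun m hm => by rw [card_insert_of_notMem hm]; omega

theorem sum_blockCount_derived (hL : ∀ l ∈ L, l ⊆ X) (k : ℕ) :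
    ∑ x ∈ X, blockCount k (derived x L) = (k + 1) * blockCount (k + 1) L := by
  simp_rw [blockCount_derived, and_comm (b := #_ = k + 1), ← filter_filter]
  rw [mul_comm, blockCount, ← smul_eq_mul, ← sum_const]
  refine (sum_card_bipartiteAbove_eq_sum_card_bipartiteBelow
    (t := {l ∈ L | #l = k + 1}) (fun (x : α) (l : Finset α) => x ∈ l)).trans ?_
  refine sum_congr rfl fun l hl => ?_
  rw [mem_filter] at hl
  rw [← hl.2, bipartiteBelow, filter_mem_eq_inter, inter_eq_right.2 (hL l hl.1)]

/-- Let `L` be a partition of `Y` and let `l` meet each part at most once. A part that meets `l` has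
at least two points unless it is a singleton, whence a lower bound for the number of singletons.
The second bound exploits the surplus of points in one particular part `m₀`. -/
theorem IsWiseBalanced.two_mul_card_le (h : IsWiseBalanced 1 Y L) (hl : l ⊆ Y)
    (hlL : ∀ m ∈ L, #(m ∩ l) ≤ 1) :
    2 * #l ≤ #{m ∈ L | #m = 1 ∧ (m ∩ l).Nonempty} + #Y ∧
    ∀ m₀ ∈ L, 2 * #l + #m₀ ≤ #{m ∈ L | #m = 1 ∧ (m ∩ l).Nonempty} + #Y + 2 := by
  have hY : ∑ m ∈ L, #m = #Y := by simpa using h.sum_choose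
  have hs : ∑ m ∈ L, #(m ∩ l) = #l := by
    rw [← card_biUnion, ← biUnion_inter, inter_eq_right.2]
    · intro y hy
      obtain ⟨m, ⟨hm, hym⟩, -⟩ := h.2 {y} (by simpa using hl hy) (by simp)
      exact mem_biUnion.2 ⟨m, hm, by simpa using hym⟩
    · intro m hm m' hm' hne
      have := h.card_inter_lt hm hm' hne
      rw [Nat.lt_one_iff, card_eq_zero, ← disjoint_iff_inter_eq_empty] at this
      exact this.mono inter_subset_left inter_subset_left
  have key : ∀ m ∈ L, 2 * #(m ∩ l) ≤ (if #m = 1 ∧ (m ∩ l).Nonempty then 1 else 0) + #m := by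
    intro m hm
    have h1 := hlL m hm
    have h2 := (h.1 m hm).2
    split_ifs with hc
    · omega
    · rw [← card_pos] at hc
      omega
  rw [card_filter, ← hY, ← hs, mul_sum, ← sum_add_distrib]
  refine ⟨sum_le_sum key, fun m₀ hm₀ => ?_⟩
  rw [← add_sum_erase L _ hm₀, ← add_sum_erase L (fun m => _ + #m) hm₀]
  have h1 := sum_le_sum fun m hm => key m (mem_of_mem_erase (a := m₀) hm)
  have h2 := hlL m₀ hm₀
  omega

end Designs

/-! ### Ordinary lines of linear spaces -/

section LinearSpaces

variable {α : Type*} {X l l' : Finset α} {L : Finset (Finset α)} {x y z w : α} [DecidableEq α]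

/-- The ordinary lines, that is, lines of size two, that pass through `x` and meet `l`; of interest
for `x` off the line `l`. -/
def ordinaryMeeting (L : Finset (Finset α)) (l : Finset α) (x : α) : Finset (Finset α) :=
  {m ∈ L | x ∈ m ∧ #m = 2 ∧ (m ∩ l).Nonempty}

/-- Projecting from `x` turns the lines through `x` into a partition of the other points, in which
the ordinary lines become singletons. -/
theorem IsWiseBalanced.card_ordinaryMeeting (h : IsWiseBalanced 2 X L) (hl : l ∈ L)
    (hx : x ∈ X \ l) :
    2 * #l + 1 ≤ #(ordinaryMeeting L l x) + #X ∧
    ∀ m ∈ L, x ∈ m → 2 * #l + #m ≤ #(ordinaryMeeting L l x) + #X + 2 := by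
  obtain ⟨hxX, hxl⟩ := mem_sdiff.1 hx
  have hO : #{m ∈ derived x L | #m = 1 ∧ (m ∩ l).Nonempty} = #(ordinaryMeeting L l x) :=
    card_filter_derived _ _ fun m hm => by
      rw [card_insert_of_notMem hm, insert_inter_of_notMem hxl]; simp
  have hX := card_erase_add_one hxX
  obtain ⟨h1, h2⟩ := (h.isWiseBalanced_derived hxX).two_mul_card_le (l := l)
    (subset_erase.2 ⟨(h.1 l hl).1, hxl⟩) fun m hm => by
      obtain ⟨hxm, hm⟩ := mem_derived.1 hm
      have hne : insert x m ≠ l := fun he => hxl (he ▸ mem_insert_self x m)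
      have := h.card_inter_lt hm hl hne
      rw [insert_inter_of_notMem hxl] at this
      omega
  rw [hO] at h1 h2
  refine ⟨by omega, fun m hm hxm => ?_⟩
  have := h2 _ (erase_mem_derived hm hxm)
  have := card_erase_add_one hxm
  omega

theorem sum_card_ordinaryMeeting_le (L : Finset (Finset α)) (X l : Finset α) :
    ∑ x ∈ X \ l, #(ordinaryMeeting L l x) ≤ blockCount 2 L := by
  have h := sum_card_bipartiteAbove_eq_sum_card_bipartiteBelow (s := X \ l)
    (t := {m ∈ L | #m = 2}) (fun x m => x ∈ m ∧ (m ∩ l).Nonempty)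
  have hO : ∀ x, ordinaryMeeting L l x =
      {m ∈ L | #m = 2}.bipartiteAbove (fun x m => x ∈ m ∧ (m ∩ l).Nonempty) x := by
    intro x
    ext m
    simp only [ordinaryMeeting, mem_filter, mem_bipartiteAbove]
    tauto
  simp_rw [hO]
  rw [h, blockCount, card_eq_sum_ones]
  refine sum_le_sum fun m hm => ?_
  have hm2 : #m = 2 := (mem_filter.1 hm).2
  -- an ordinary line that meets `l` has at most one point off `l`
  by_cases hne : (m ∩ l).Nonempty
  · have h1 : (X \ l).bipartiteBelow (fun x m => x ∈ m ∧ (m ∩ l).Nonempty) m ⊆ m \ l := by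
      intro x hx
      simp only [mem_bipartiteBelow, mem_sdiff] at hx ⊢
      exact ⟨hx.2.1, hx.1.2⟩
    have h2 := card_le_card h1
    have h3 := card_sdiff_add_card_inter m l
    have h4 := hne.card_pos
    omega
  · rw [bipartiteBelow, filter_false_of_mem]
    · simp
    · exact fun x _ hx => hne hx.2

/-- With `k = #l` and `n = #X` this says that there are at least `(n - k) * (2 * k + 1 - n)`
ordinary lines. -/
theorem IsWiseBalanced.mul_le_blockCount_two (h : IsWiseBalanced 2 X L) (hl : l ∈ L) :
    #(X \ l) * (2 * #l + 1) ≤ blockCount 2 L + #(X \ l) * #X := by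
  have h1 := sum_card_ordinaryMeeting_le L X l
  have h2 := sum_le_sum fun x hx => (h.card_ordinaryMeeting hl (x := x) hx).1
  rw [sum_const, sum_add_distrib, sum_const, smul_eq_mul, smul_eq_mul] at h2
  omega

/-- Each of the four points off `l` lies on an ordinary line that meets `l`, and those on the second
long line `l'` lie on two, since `l'` uses up an additional point. -/
theorem IsWiseBalanced.five_le_blockCount_two (h : IsWiseBalanced 2 X L) (hX : #X = 8)
    (hl : l ∈ L) (hl' : l' ∈ L) (hne : l ≠ l') (hc : #l = 4) (hc' : #l' = 4) :
    5 ≤ blockCount 2 L := by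
  have h1 := sum_card_ordinaryMeeting_le L X l
  have h2 : ∀ x ∈ X \ l, 1 + (if x ∈ l' then 1 else 0) ≤ #(ordinaryMeeting L l x) := by
    intro x hx
    obtain ⟨h3, h4⟩ := h.card_ordinaryMeeting hl hx
    split_ifs with hx'
    · have := h4 l' hl' hx'
      omega
    · omega
  have h3 := sum_le_sum h2
  rw [sum_add_distrib, ← card_filter, ← card_eq_sum_ones] at h3
  have h4 : {x ∈ X \ l | x ∈ l'} = l' \ l := by
    ext x
    simp only [mem_filter, mem_sdiff]
    exact ⟨fun hx => ⟨hx.2, hx.1.2⟩, fun hx => ⟨⟨(h.1 l' hl').1 hx.1, hx.2⟩, hx.1⟩⟩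
  have h5 := card_sdiff_add_card_inter l' l
  have h6 := h.card_inter_lt hl' hl hne.symm
  have h7 := card_sdiff_add_card_eq_card (h.1 l hl).1
  rw [h4] at h3
  omega

/-- Counting the other points along the lines through `x`. -/
theorem IsWiseBalanced.blockCount_derived_eq (h : IsWiseBalanced 2 X L) (hX : #X = 8)
    (h3 : ∀ l ∈ L, #l ≤ 3) (hx : x ∈ X) :
    blockCount 1 (derived x L) + 2 * blockCount 2 (derived x L) = 7 := by
  have h1 := (h.isWiseBalanced_derived hx).sum_choose
  have hX := card_erase_add_one hx
  have h2 : ∀ m ∈ derived x L,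
      (#m).choose 1 = (if #m = 1 then 1 else 0) + 2 * (if #m = 2 then 1 else 0) := by
    intro m hm
    have hc := ((h.isWiseBalanced_derived hx).1 m hm).2
    obtain ⟨hxm, hm⟩ := mem_derived.1 hm
    have := h3 _ hm
    rw [card_insert_of_notMem hxm] at this
    rw [Nat.choose_one_right]
    have hm2 : #m ≤ 2 := by omega
    generalize #m = n at hc hm2
    interval_cases n <;> simp
  rw [sum_congr rfl h2, sum_add_distrib, ← mul_sum, ← card_filter, ← card_filter] at h1
  rw [Nat.choose_one_right] at h1
  simp only [blockCount]
  omega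

theorem IsWiseBalanced.eq_of_mem (h : IsWiseBalanced 2 X L) (hxy : x ≠ y) (hl : l ∈ L)
    (hl' : l' ∈ L) (hx : x ∈ l) (hy : y ∈ l) (hx' : x ∈ l') (hy' : y ∈ l') : l = l' :=
  h.eq_of_subset (card_pair hxy) hl hl' (by simp [insert_subset_iff, *])
    (by simp [insert_subset_iff, *])

theorem IsWiseBalanced.collinear_unique (h : IsWiseBalanced 2 X L) (h3 : ∀ l ∈ L, #l ≤ 3)
    (hz : Collinear L x y z) (hw : Collinear L x y w) : z = w := by
  obtain ⟨⟨h1, h2, h4⟩, l, hl, hxl, hyl, hzl⟩ := hz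
  obtain ⟨⟨-, h5, h6⟩, l', hl', hxl', hyl', hwl'⟩ := hw
  obtain rfl := h.eq_of_mem h1 hl hl' hxl hyl hxl' hyl'
  by_contra hne
  have : #({x, y, z, w} : Finset α) ≤ #l := card_le_card (by simp [insert_subset_iff, *])
  have h7 : #({x, y, z, w} : Finset α) = 4 := by
    rw [card_insert_of_notMem, card_insert_of_notMem, card_pair hne] <;> simp [*]
  have := h3 l hl
  omega

end LinearSpaces

/-! ### Recognising the Möbius–Kantor configuration -/

section MoebiusKantor

variable {α : Type*} {X : Finset α} {L : Finset (Finset α)}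

/-- The points `a, b, c, d, a', b', c', d'` form a Möbius–Kantor configuration: an affine plane of
order three with one point removed, in which `x` and `x'` lie on a line through the missing point.
The last three conditions are the only nondegeneracy that is asked for. -/
def IsMoebiusKantor (L : Finset (Finset α)) (a b c d a' b' c' d' : α) : Prop :=
  Collinear L a b c ∧ Collinear L a d b' ∧ Collinear L b d c' ∧ Collinear L c d a' ∧
  Collinear L a c' d' ∧ Collinear L b a' d' ∧ Collinear L c b' d' ∧ Collinear L b' c' a' ∧
  ¬ Collinear L a b d ∧ a ≠ d ∧ b ≠ d

/-- The Möbius–Kantor configuration is determined by two of its lines. Here `a'`, `b'`, `c'`, `d'`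
are the partners of `a`, `b`, `c`, `d`, and the existential hypotheses say that certain pairs lie on
a line with a third of the eight points; all but one candidate for that point is excluded. -/
theorem moebiusKantor_of_third_points {C : α → α → α → Prop}
    (hu : ∀ x y z w, C x y z → C x y w → z = w)
    (hne : ∀ x y z, C x y z → x ≠ y ∧ y ≠ z ∧ x ≠ z) (hsw : ∀ x y z, C x y z → C y x z)
    (hro : ∀ x y z, C x y z → C y z x) {a b c d a' b' c' d' : α}
    (ha : ∀ z, ¬ C a a' z) (hb : ∀ z, ¬ C b b' z) (hc : ∀ z, ¬ C c c' z) (hd : ∀ z, ¬ C d d' z)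
    (hnd : [a, b, c, d, a', b', c', d'].Nodup) (habc : C a b c) (hadb : C a d b')
    (hbd : ∃ z ∈ [a, b, c, d, a', b', c', d'], C b d z)
    (hcd : ∃ z ∈ [a, b, c, d, a', b', c', d'], C c d z)
    (hac' : ∃ z ∈ [a, b, c, d, a', b', c', d'], C a c' z)
    (hbd' : ∃ z ∈ [a, b, c, d, a', b', c', d'], C b d' z)
    (hcd' : ∃ z ∈ [a, b, c, d, a', b', c', d'], C c d' z)
    (hbc' : ∃ z ∈ [a, b, c, d, a', b', c', d'], C b' c' z) :
    C b d c' ∧ C c d a' ∧ C a c' d' ∧ C b a' d' ∧ C c b' d' ∧ C b' c' a' := by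
  simp only [List.mem_cons, List.not_mem_nil, or_false, exists_eq_or_imp, exists_eq_left] at *
  simp only [List.nodup_cons, List.mem_cons, List.not_mem_nil, or_false, not_or] at hnd
  have g2 : C c d a' := by
    clear hbd hac' hbd' hcd' hbc'
    rcases hcd with h | h | h | h | h | h | h | h <;> grind
  have g1 : C b d c' := by
    clear hcd hac' hbd' hcd' hbc'
    rcases hbd with h | h | h | h | h | h | h | h <;> grind
  have g3 : C a c' d' := by
    clear hcd hbd hbd' hcd' hbc'
    rcases hac' with h | h | h | h | h | h | h | h <;> grind
  have g4 : C b d' a' := by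
    clear hcd hac' hbd hcd' hbc'
    rcases hbd' with h | h | h | h | h | h | h | h <;> grind
  have g5 : C c d' b' := by
    clear hcd hac' hbd' hbd hbc'
    rcases hcd' with h | h | h | h | h | h | h | h <;> grind
  have g6 : C b' c' a' := by
    clear hcd hac' hbd' hcd' hbd
    rcases hbc' with h | h | h | h | h | h | h | h <;> grind
  exact ⟨g1, g2, g3, hro _ _ _ (hsw _ _ _ g4), hro _ _ _ (hsw _ _ _ g5), g6⟩

variable [DecidableEq α]

theorem IsWiseBalanced.exists_mem (h : IsWiseBalanced 2 X L) {x y : α} (hx : x ∈ X) (hy : y ∈ X)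
    (hxy : x ≠ y) : ∃ l ∈ L, x ∈ l ∧ y ∈ l := by
  obtain ⟨l, ⟨hl, hs⟩, -⟩ := h.2 {x, y} (by simp [insert_subset_iff, *]) (card_pair hxy)
  exact ⟨l, hl, by simp_all [insert_subset_iff]⟩

/-- If each point lies on exactly one ordinary line, then every point `x` has a partner `x'` such
that any two points not partners of each other lie on a line with a third point. -/
theorem IsWiseBalanced.exists_partner (h : IsWiseBalanced 2 X L)
    (h1 : ∀ x ∈ X, blockCount 1 (derived x L) = 1) :
    ∃ σ : α → α, (∀ x ∈ X, σ x ∈ X ∧ σ x ≠ x ∧ σ (σ x) = x) ∧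
      (∀ x y z, Collinear L x y z → (∀ l ∈ L, #l ≤ 3) → y ≠ σ x) ∧
      (∀ x ∈ X, ∀ y ∈ X, x ≠ y → y ≠ σ x → ∃ z, Collinear L x y z) := by
  have h2 : ∀ x ∈ X, ∃ y, y ≠ x ∧ ({x, y} : Finset α) ∈ L ∧
      ∀ l ∈ L, x ∈ l → #l = 2 → l = {x, y} := by
    intro x hx
    have := h1 x hx
    rw [blockCount_derived, card_eq_one] at this
    obtain ⟨l, hl⟩ := this
    have hmem : ∀ m, m ∈ L ∧ x ∈ m ∧ #m = 2 ↔ m = l := fun m => by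
      rw [show m = l ↔ m ∈ ({l} : Finset _) from mem_singleton.symm, ← hl, mem_filter]
    obtain ⟨hlL, hxl, hc⟩ := (hmem l).2 rfl
    obtain ⟨y, hy⟩ := card_eq_one.1 (show #(l.erase x) = 1 by rw [card_erase_of_mem hxl, hc])
    have hly : l = {x, y} := by rw [← insert_erase hxl, hy]
    refine ⟨y, ?_, hly ▸ hlL, fun m hm hxm hmc => hly ▸ (hmem m).1 ⟨hm, hxm, hmc⟩⟩
    have : y ∈ l.erase x := by simp [hy]
    exact (mem_erase.1 this).1
  choose! σ hσ1 hσ2 hσ3 using h2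
  have hX : ∀ x ∈ X, σ x ∈ X := fun x hx => (h.1 _ (hσ2 x hx)).1 (by simp)
  refine ⟨σ, fun x hx => ⟨hX x hx, hσ1 x hx, ?_⟩, ?_, ?_⟩
  · have := hσ3 _ (hX x hx) _ (hσ2 x hx) (by simp) (card_pair (hσ1 x hx).symm)
    have hm : x ∈ ({σ x, σ (σ x)} : Finset α) := this ▸ mem_insert_self _ _
    rw [mem_insert, mem_singleton] at hm
    exact (hm.resolve_left (hσ1 x hx).symm).symm
  · rintro x y z ⟨⟨hxy, hyz, hxz⟩, l, hl, hxl, hyl, hzl⟩ - rfl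
    have hx := (h.1 l hl).1 hxl
    obtain rfl := h.eq_of_mem hxy hl (hσ2 x hx) hxl hyl (by simp) (by simp)
    simp only [mem_insert, mem_singleton] at hzl
    rcases hzl with rfl | rfl
    · exact hxz rfl
    · exact hyz rfl
  · intro x hx y hy hxy hne
    obtain ⟨l, hl, hxl, hyl⟩ := h.exists_mem hx hy hxy
    by_contra! hz
    have hlxy : l = {x, y} := by
      refine Subset.antisymm (fun z hzl => ?_) (by simp [insert_subset_iff, *])
      by_contra hzn
      simp only [mem_insert, mem_singleton, not_or] at hzn
      exact hz z ⟨⟨hxy, fun e => hzn.2 e.symm, fun e => hzn.1 e.symm⟩, l, hl, hxl, hyl, hzl⟩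
    have := hσ3 x hx l hl hxl (hlxy ▸ card_pair hxy)
    have hm : y ∈ ({x, σ x} : Finset α) := this ▸ hyl
    simp only [mem_insert, mem_singleton] at hm
    exact hm.elim (fun e => hxy e.symm) hne

/-- A linear space of eight points in which each point lies on one line of size two and
three of size three is the Möbius–Kantor configuration. -/
theorem IsWiseBalanced.exists_isMoebiusKantor (h : IsWiseBalanced 2 X L) (hX : #X = 8)
    (h3 : ∀ l ∈ L, #l ≤ 3) (h1 : ∀ x ∈ X, blockCount 1 (derived x L) = 1) :
    ∃ a b c d a' b' c' d', IsMoebiusKantor L a b c d a' b' c' d' := by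
  obtain ⟨σ, hσ, hC, hex⟩ := h.exists_partner h1
  replace hC := fun x y z hxyz => hC x y z hxyz h3
  have hu := fun x y z w => h.collinear_unique h3 (x := x) (y := y) (z := z) (w := w)
  have hmem : ∀ x y z, Collinear L x y z → z ∈ X := fun x y z hxyz => by
    obtain ⟨-, l, hl, -, -, hz⟩ := hxyz
    exact (h.1 l hl).1 hz
  have hne : ∀ x y z, Collinear L x y z → x ≠ y ∧ y ≠ z ∧ x ≠ z := fun x y z hxyz => hxyz.1
  have hsw := fun x y z => Collinear.swap (L := L) (x := x) (y := y) (z := z)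
  have hro := fun x y z => Collinear.rotate (L := L) (x := x) (y := y) (z := z)
  have hinj : ∀ x ∈ X, ∀ y ∈ X, σ x = σ y → x = y := fun x hx y hy he => by
    rw [← (hσ x hx).2.2, he, (hσ y hy).2.2]
  -- three collinear points, another point and their partners exhaust the space
  have hcov : ∀ a ∈ X, ∀ b ∈ X, ∀ c ∈ X, ∀ d ∈ X, Collinear L a b c →
      d ∉ ({a, σ a, b, σ b, c, σ c} : Finset α) →
      [a, b, c, d, σ a, σ b, σ c, σ d].Nodup ∧
      ∀ z ∈ X, z ∈ [a, b, c, d, σ a, σ b, σ c, σ d] := by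
    intro a ha b hb c hc d hd habc hdn
    simp only [mem_insert, mem_singleton, not_or] at hdn
    have ha' := hσ a ha
    have hb' := hσ b hb
    have hc' := hσ c hc
    have hd' := hσ d hd
    have hnd : [a, b, c, d, σ a, σ b, σ c, σ d].Nodup := by
      obtain ⟨hab, hbc, hac⟩ := hne _ _ _ habc
      have hba' := hC _ _ _ habc
      have hca' := hC _ _ _ (hro _ _ _ (hsw _ _ _ habc))
      have hcb' := hC _ _ _ (hro _ _ _ habc)
      clear hex hC hu hmem hne hsw hro habc h1 h3 h
      simp only [List.nodup_cons, List.mem_cons, List.not_mem_nil, or_false, not_or,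
        List.nodup_nil, not_false_eq_true, and_true]
      grind
    refine ⟨hnd, fun z hz => ?_⟩
    have hcard : #({a, b, c, d, σ a, σ b, σ c, σ d} : Finset α) = 8 := by
      simpa using List.toFinset_card_of_nodup hnd
    have hXe := eq_of_subset_of_card_le (s := {a, b, c, d, σ a, σ b, σ c, σ d}) (t := X)
      (by simp [insert_subset_iff, *]) (by omega)
    rw [← hXe] at hz
    simpa using hz
  -- once the line through `a` and `d` contains a partner, everything is determined
  have main : ∀ a ∈ X, ∀ b ∈ X, ∀ c ∈ X, ∀ d ∈ X, Collinear L a b c → Collinear L a d (σ b) →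
      d ∉ ({a, σ a, b, σ b, c, σ c} : Finset α) →
      ∃ a b c d a' b' c' d', IsMoebiusKantor L a b c d a' b' c' d' := by
    intro a ha b hb c hc d hd habc hadb hdn
    obtain ⟨hnd, hXe⟩ := hcov a ha b hb c hc d hd habc hdn
    refine ⟨a, b, c, d, σ a, σ b, σ c, σ d, ?_⟩
    have hb' := hσ b hb
    have hc' := hσ c hc
    have hd' := hσ d hd
    have hn := hnd
    simp only [List.nodup_cons, List.mem_cons, List.not_mem_nil, or_false, not_or] at hn
    have third : ∀ x ∈ X, ∀ y ∈ X, x ≠ y → y ≠ σ x → ∃ z ∈ [a, b, c, d, σ a, σ b, σ c, σ d],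
        Collinear L x y z := by
      intro x hx y hy hxy hyx
      obtain ⟨z, hz⟩ := hex x hx y hy hxy hyx
      exact ⟨z, hXe z (hmem _ _ _ hz), hz⟩
    clear hcov hex
    obtain ⟨g1, g2, g3, g4, g5, g6⟩ := moebiusKantor_of_third_points hu hne hsw hro
      (fun z hz => hC _ _ _ hz rfl) (fun z hz => hC _ _ _ hz rfl)
      (fun z hz => hC _ _ _ hz rfl) (fun z hz => hC _ _ _ hz rfl) hnd habc hadb
      (third b hb d hd (by grind) (by grind))
      (third c hc d hd (by grind) (by grind))
      (third a ha (σ c) hc'.1 (by grind) (by grind))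
      (third b hb (σ d) hd'.1 (by grind) (by grind))
      (third c hc (σ d) hd'.1 (by grind) (by grind))
      (third (σ b) hb'.1 (σ c) hc'.1 (by grind) (by grind))
    exact ⟨habc, hadb, g1, g2, g3, g4, g5, g6, fun hh => hn.2.2.1.1 (hu _ _ _ _ habc hh),
      hn.1.2.2.1, hn.2.1.2.1⟩
  have hpick : ∀ T : Finset α, #T < 8 → ∃ x ∈ X, x ∉ T := fun T hT =>
    exists_mem_notMem_of_card_lt_card (by omega)
  obtain ⟨a, ha, -⟩ := hpick ∅ (by simp)
  obtain ⟨b, hb, hbn⟩ := hpick {a, σ a} (card_le_two.trans_lt (by omega))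
  simp only [mem_insert, mem_singleton, not_or] at hbn
  obtain ⟨c, hc⟩ := hex a ha b hb (Ne.symm hbn.1) hbn.2
  have hcX := hmem _ _ _ hc
  obtain ⟨d, hd, hdn⟩ := hpick {a, σ a, b, σ b, c, σ c} (card_le_six.trans_lt (by omega))
  have hdn' := hdn
  simp only [mem_insert, mem_singleton, not_or] at hdn'
  obtain ⟨z, hz⟩ := hex a ha d hd (Ne.symm hdn'.1) hdn'.2.1
  -- the third point on the line through `a` and `d` is `σ b` or `σ c`; these cases are symmetric
  by_cases hzb : z = σ b
  · exact main a ha b hb c hcX d hd hc (hzb ▸ hz) hdn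
  by_cases hzc : z = σ c
  · exact main a ha c hcX b hb d hd (hro _ _ _ (hsw _ _ _ hc)) (hzc ▸ hz)
      (by simp only [mem_insert, mem_singleton, not_or]; tauto)
  have hzX := (hcov a ha b hb c hcX d hd hc hdn).2 z (hmem _ _ _ hz)
  simp only [List.mem_cons, List.not_mem_nil, or_false] at hzX
  clear main hcov hex hpick h1 hinj h3 h hdn
  rcases hzX with rfl | rfl | rfl | rfl | rfl | rfl | rfl | rfl <;> grind

end MoebiusKantor

/-! ### The Möbius–Kantor configuration is not real -/

section Real

variable {V : Type*} [AddCommGroup V] [Module ℝ V]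

/-- The vector `z` is, modulo the line spanned by `p`, a combination of `x` and `y` with both
coefficients nonzero. -/
def IsCombination (p x y z : V) : Prop :=
  ∃ r s t : ℝ, r ≠ 0 ∧ s ≠ 0 ∧ z = r • x + s • y + t • p

/-- The Möbius–Kantor configuration cannot be realised over the reals: its coordinates would
involve a root of `u² + u + 1`. -/
theorem false_of_isCombination {p a b c d a' b' c' d' : V}
    (hli : LinearIndependent ℝ ![a, b, d, p])
    (h1 : IsCombination p a b c) (h2 : IsCombination p a d b') (h3 : IsCombination p b d c')
    (h4 : IsCombination p c d a') (h5 : IsCombination p a c' d') (h6 : IsCombination p b a' d')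
    (h7 : IsCombination p c b' d') (h8 : IsCombination p b' c' a') : False := by
  obtain ⟨c1, c2, c3, hc1, hc2, rfl⟩ := h1
  obtain ⟨k1, k2, k3, hk1, hk2, rfl⟩ := h2
  obtain ⟨m1, m2, m3, hm1, hm2, rfl⟩ := h3
  obtain ⟨n1, n2, n3, hn1, hn2, rfl⟩ := h4
  obtain ⟨q0, q, q3, hq0, hq, rfl⟩ := h5
  obtain ⟨r, s, s3, hr, hs, h6⟩ := h6
  obtain ⟨u, v, v3, hu, hv, h7⟩ := h7
  obtain ⟨f, g, g3, hf, hg, h8⟩ := h8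
  -- only the coordinates at `a`, `b`, `d` matter
  have key : ∀ x y z w x' y' z' w' : ℝ, x • a + y • b + z • d + w • p =
      x' • a + y' • b + z' • d + w' • p → x = x' ∧ y = y' ∧ z = z' := by
    intro x y z w x' y' z' w' he
    have h0 := Fintype.linearIndependent_iff.1 hli ![x - x', y - y', z - z', w - w'] (by
      rw [Fin.sum_univ_four]
      simp only [Matrix.cons_val, sub_smul]
      rw [← sub_eq_zero] at he
      rw [← he]
      abel)
    exact ⟨sub_eq_zero.1 (h0 0), sub_eq_zero.1 (h0 1), sub_eq_zero.1 (h0 2)⟩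
  -- compare the expression for `d'` on the line `ac'd'` with those on `ba'd'` and on `cb'd'`, and
  -- then the two expressions for `a'`
  obtain ⟨e1, -, e3⟩ := key q0 (q * m1) (q * m2) (q * m3 + q3)
    (s * (n1 * c1)) (r + s * (n1 * c2)) (s * n2) (s * (n1 * c3 + n3) + s3) (by
      linear_combination (norm := module) h6)
  obtain ⟨e4, e5, e6⟩ := key q0 (q * m1) (q * m2) (q * m3 + q3)
    (u * c1 + v * k1) (u * c2) (v * k2) (u * c3 + v * k3 + v3) (by
      linear_combination (norm := module) h7)
  obtain ⟨e7, e8, e9⟩ := key (n1 * c1) (n1 * c2) n2 (n1 * c3 + n3)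
    (f * k1) (g * m1) (f * k2 + g * m2) (f * k3 + g * m3 + g3) (by
      linear_combination (norm := module) h8)
  -- with `A = f * k2` and `B = g * m2` the equations give `A² + A * B + B² = 0`
  have i1 : u * c1 * k2 = -(s * k1 * (g * m2)) := by
    linear_combination -k2 * e4 + k2 * e1 + k2 * s * e7 + k1 * e6 - k1 * e3 - k1 * s * e9
  have i2 : u * c2 * m2 = m1 * s * n2 := by linear_combination -m2 * e5 + m1 * e3
  have i3 : c1 * (g * m1) = c2 * (f * k1) := by linear_combination -c1 * e8 + c2 * e7
  have hq : k1 * m1 * s * ((f * k2) ^ 2 + f * k2 * (g * m2) + (g * m2) ^ 2) = 0 := by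
    linear_combination -f * k1 * k2 * i2 + g * m1 * m2 * i1 - u * k2 * m2 * i3
      - m1 * s * f * k1 * k2 * e9
  have hfk : f * k2 ≠ 0 := mul_ne_zero hf hk2
  have hpos : 0 < (f * k2) ^ 2 + f * k2 * (g * m2) + (g * m2) ^ 2 := by
    nlinarith [sq_nonneg (f * k2 + 2 * (g * m2)), sq_pos_of_ne_zero hfk]
  exact mul_ne_zero (mul_ne_zero (mul_ne_zero hk1 hm1) hs) hpos.ne' hq

end Real

/-! ### Counting small blocks on eight and on nine points -/

section Counting

variable {α : Type*} [DecidableEq α] {X S : Finset α} {L 𝓑 : Finset (Finset α)}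

/-- The combinatorial substitute for Melchior's inequality on eight points. -/
theorem IsWiseBalanced.four_le_blockCount_two (h : IsWiseBalanced 2 X L) (hX : #X = 8)
    (hXL : X ∉ L) (hMK : ∀ a b c d a' b' c' d', ¬ IsMoebiusKantor L a b c d a' b' c' d') :
    4 ≤ blockCount 2 L ∧ (blockCount 2 L = 4 → blockCount 4 L = 1 ∧ ∀ l ∈ L, #l ≤ 4) := by
  have hcount : ∀ l ∈ L, 4 ≤ #l → 4 ≤ blockCount 2 L ∧ (4 < #l → 4 < blockCount 2 L) := by
    intro l hl hc
    have h7 : #l < 8 := by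
      rw [← hX]
      exact card_lt_card ((h.1 l hl).1.ssubset_of_ne fun e => hXL (e ▸ hl))
    have h1 := h.mul_le_blockCount_two hl
    rw [card_sdiff_of_subset (h.1 l hl).1, hX] at h1
    generalize #l = k at *
    interval_cases k <;> omega
  by_cases h3 : ∀ l ∈ L, #l ≤ 3
  · -- seven is odd, so each point lies on an ordinary line
    have hs : ∑ x ∈ X, blockCount 1 (derived x L) = 2 * blockCount 2 L :=
      sum_blockCount_derived (fun l hl => (h.1 l hl).1) 1
    have h1 : ∀ x ∈ X, 1 ≤ blockCount 1 (derived x L) := fun x hx => by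
      have := h.blockCount_derived_eq hX h3 hx
      omega
    have h2 := sum_le_sum h1
    rw [← card_eq_sum_ones, hX, hs] at h2
    refine ⟨by omega, fun h4 => ?_⟩
    rw [h4] at hs
    have h5 := (sum_eq_sum_iff_of_le h1).1 (by rw [hs, ← card_eq_sum_ones, hX])
    obtain ⟨a, b, c, d, a', b', c', d', hk⟩ :=
      h.exists_isMoebiusKantor hX h3 fun x hx => (h5 x hx).symm
    exact (hMK _ _ _ _ _ _ _ _ hk).elim
  · push Not at h3
    obtain ⟨l, hl, hl3⟩ := h3
    refine ⟨(hcount l hl hl3).1, fun h4 => ?_⟩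
    have hle : ∀ m ∈ L, #m ≤ 4 := fun m hm => by
      by_contra! hm4
      have := (hcount m hm hm4.le).2 hm4
      omega
    refine ⟨card_eq_one.2 ⟨l, ?_⟩, hle⟩
    have hl4 := le_antisymm (hle l hl) hl3
    ext m
    rw [mem_filter, mem_singleton]
    refine ⟨fun hm => ?_, fun e => e ▸ ⟨hl, hl4⟩⟩
    by_contra hne
    have := h.five_le_blockCount_two hX hm.1 hl hne hm.2 hl4
    omega

/-- The combinatorial form of the bound for nine points in space. -/
theorem IsWiseBalanced.fourteen_le_blockCount_three (h : IsWiseBalanced 3 S 𝓑) (hS : #S = 9)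
    (hSB : S ∉ 𝓑)
    (hMK : ∀ p ∈ S, ∀ a b c d a' b' c' d', ¬ IsMoebiusKantor (derived p 𝓑) a b c d a' b' c' d') :
    14 ≤ blockCount 3 𝓑 := by
  have hp : ∀ p ∈ S, 4 ≤ blockCount 2 (derived p 𝓑) ∧ (blockCount 2 (derived p 𝓑) = 4 →
      blockCount 4 (derived p 𝓑) = 1 ∧ ∀ l ∈ derived p 𝓑, #l ≤ 4) := by
    intro p hp
    refine (h.isWiseBalanced_derived hp).four_le_blockCount_two
      (by rw [card_erase_of_mem hp, hS]) (fun hm => hSB ?_) (hMK p hp)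
    rw [← insert_erase hp]
    exact (mem_derived.1 hm).2
  have hsub : ∀ B ∈ 𝓑, B ⊆ S := fun B hB => (h.1 B hB).1
  have hs2 := sum_blockCount_derived hsub 2
  have hs4 := sum_blockCount_derived hsub 4
  have h36 := sum_le_sum fun p hpS => (hp p hpS).1
  rw [sum_const, hS, hs2, smul_eq_mul] at h36
  norm_num at h36 hs2 hs4
  by_contra! hlt
  obtain h12 | h13 : blockCount 3 𝓑 = 12 ∨ blockCount 3 𝓑 = 13 := by omega
  · -- each point lies on exactly one plane with five points
    have h4 := (sum_eq_sum_iff_of_le fun p hpS => (hp p hpS).1).1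
      (by rw [sum_const, hS, hs2, h12, smul_eq_mul])
    rw [sum_congr rfl fun p hpS => ((hp p hpS).2 (h4 p hpS).symm).1, sum_const, hS,
      smul_eq_mul] at hs4
    omega
  · -- by parity, some plane has seven points
    have h7 : ∃ B ∈ 𝓑, #B = 7 := by
      by_contra! h7
      have hmod : ∀ B ∈ 𝓑, ∃ n, (#B).choose 3 = (if #B = 3 then 1 else 0) + 2 * n := by
        intro B hB
        have h1 := (h.1 B hB).2
        have h2 : #B < 9 := by
          rw [← hS]
          exact card_lt_card ((hsub B hB).ssubset_of_ne fun e => hSB (e ▸ hB))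
        have h3 := h7 B hB
        refine ⟨((#B).choose 3 - if #B = 3 then 1 else 0) / 2, ?_⟩
        generalize #B = k at *
        interval_cases k <;> first | rfl | exact absurd rfl h3
      choose! n hn using hmod
      have hsum := h.sum_choose
      rw [sum_congr rfl hn, sum_add_distrib, ← card_filter, ← mul_sum, hS] at hsum
      have h84 : Nat.choose 9 3 = 84 := rfl
      unfold blockCount at h13
      omega
    obtain ⟨B, hB, hB7⟩ := h7
    have h5 : ∀ p ∈ S, 4 + (if p ∈ B then 1 else 0) ≤ blockCount 2 (derived p 𝓑) := by
      intro p hpS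
      obtain ⟨h1, h2⟩ := hp p hpS
      split_ifs with hpB
      · by_contra! h3
        have := (h2 (by omega)).2 _ (erase_mem_derived hB hpB)
        rw [card_erase_of_mem hpB] at this
        omega
      · exact h1
    have h6 := sum_le_sum h5
    rw [sum_add_distrib, ← card_filter, filter_mem_eq_inter, inter_eq_right.2 (hsub B hB), hB7,
      sum_const, hS, hs2, h13, smul_eq_mul] at h6
    omega

end Counting

/-! ### Spans of projective points -/

section Sections

variable {K V : Type*} [DivisionRing K] [AddCommGroup V] [Module K V]

theorem submodule_span_image_mk {ι : Type*} (v : ι → V) (hv : ∀ i, v i ≠ 0) (s : Set ι) :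
    Projectivization.Subspace.submodule
      (Projectivization.Subspace.span ((fun i => Projectivization.mk K (v i) (hv i)) '' s)) =
    Submodule.span K (v '' s) := by
  refine le_antisymm ?_ ?_
  · rw [← OrderIso.le_symm_apply, Projectivization.Subspace.span_le_subspace_iff]
    rintro - ⟨i, hi, rfl⟩
    exact (Submodule.mk_mem_projectivization_iff _ (hv i)).2
      (Submodule.subset_span (Set.mem_image_of_mem v hi))
  · rw [Submodule.span_le]
    rintro - ⟨i, hi, rfl⟩
    exact (Projectivization.Subspace.mem_submodule_iff _ (hv i)).2
      (Projectivization.Subspace.subset_span _ ⟨i, hi, rfl⟩)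

theorem submodule_span (T : Set (ℙ K V)) :
    Projectivization.Subspace.submodule (Projectivization.Subspace.span T) =
    Submodule.span K (Projectivization.rep '' T) := by
  have := submodule_span_image_mk (K := K) (fun x : ℙ K V => x.rep) (fun x => x.rep_nonzero) T
  simpa using this

theorem rep_mem_submodule_iff {H : Projectivization.Subspace K V} {x : ℙ K V} :
    x.rep ∈ Projectivization.Subspace.submodule H ↔ x ∈ H := by
  rw [Projectivization.Subspace.mem_submodule_iff _ x.rep_nonzero, Projectivization.mk_rep]

end Sections

/-! ### Hyperplane sections of an admissible set -/

section Blocks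

variable {d : ℕ} {S T : Finset (PG d)}

open Classical in
/-- The section of `S` by the projective subspace spanned by `T`. -/
noncomputable def spanSection (S T : Finset (PG d)) : Finset (PG d) :=
  {x ∈ S | x ∈ Projectivization.Subspace.span (T : Set (PG d))}

open Classical in
/-- The sections of `S` by the hyperplanes spanned by `d` points of `S`. -/
noncomputable def blocks (S : Finset (PG d)) : Finset (Finset (PG d)) :=
  (powersetCard d S).image (spanSection S)

theorem mem_spanSection {x : PG d} :
    x ∈ spanSection S T ↔ x ∈ S ∧ x ∈ Projectivization.Subspace.span (T : Set (PG d)) := by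
  simp [spanSection]

theorem mem_blocks {B : Finset (PG d)} :
    B ∈ blocks S ↔ ∃ T ⊆ S, #T = d ∧ spanSection S T = B := by
  simp [blocks, mem_powersetCard, and_assoc]

theorem subset_spanSection (hT : T ⊆ S) : T ⊆ spanSection S T := fun _ hx =>
  mem_spanSection.2 ⟨hT hx, Projectivization.Subspace.subset_span _ hx⟩

/-- Two hyperplanes, one of which contains the other, coincide. -/
theorem IsHyperplane.eq_of_le {H H' : PGSubspace d} (hH : IsHyperplane H) (hH' : IsHyperplane H')
    (hle : H ≤ H') : H = H' :=
  Projectivization.Subspace.submodule.injective <| Submodule.eq_of_le_of_finrank_eq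
    (Projectivization.Subspace.submodule.monotone hle) (hH.trans hH'.symm)

theorem IsAdmissible.span_eq (hS : IsAdmissible S) (hT : T ⊆ S) (hc : #T = d) {H : PGSubspace d}
    (hH : IsHyperplane H) (hTH : (T : Set (PG d)) ⊆ H) :
    Projectivization.Subspace.span (T : Set (PG d)) = H :=
  (hS.1 T hT hc).eq_of_le hH (Projectivization.Subspace.span_le_subspace_iff.2 hTH)

theorem IsAdmissible.isWiseBalanced_blocks (hS : IsAdmissible S) :
    IsWiseBalanced d S (blocks S) := by
  constructor
  · intro B hB
    obtain ⟨T, hT, hc, rfl⟩ := mem_blocks.1 hB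
    exact ⟨fun x hx => (mem_spanSection.1 hx).1,
      hc.ge.trans (card_le_card (subset_spanSection hT))⟩
  · intro T hT hc
    refine ⟨spanSection S T, ⟨mem_blocks.2 ⟨T, hT, hc, rfl⟩, subset_spanSection hT⟩, ?_⟩
    rintro B ⟨hB, hTB⟩
    obtain ⟨U, hU, hUc, rfl⟩ := mem_blocks.1 hB
    have := hS.span_eq hT hc (hS.1 U hU hUc) fun x hx => (mem_spanSection.1 (hTB hx)).2
    rw [spanSection, spanSection, this]

theorem IsAdmissible.notMem_blocks (hS : IsAdmissible S) : S ∉ blocks S := by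
  intro h
  obtain ⟨T, hT, hc, he⟩ := mem_blocks.1 h
  refine hS.2 ⟨_, hS.1 T hT hc, fun x hx => ?_⟩
  rw [mem_coe, ← he] at hx
  exact (mem_spanSection.1 hx).2

open Classical in
/-- An ordinary hyperplane is spanned by the `d` points of `S` on it, which form a block. -/
theorem IsAdmissible.ncard_ordinaryHyperplanes (hS : IsAdmissible S) :
    (ordinaryHyperplanes S).ncard = blockCount d (blocks S) := by
  have hmem : ∀ B ∈ blocks S, #B = d → B ⊆ S ∧ spanSection S B = B := by
    intro B hB hBc
    obtain ⟨T, hT, hc, rfl⟩ := mem_blocks.1 hB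
    have he := eq_of_subset_of_card_le (subset_spanSection hT) (by omega)
    exact ⟨he ▸ hT, by rw [← he, ← he]⟩
  have himage : ordinaryHyperplanes S =
      (fun B : Finset (PG d) => Projectivization.Subspace.span (B : Set (PG d))) ''
        ({B ∈ blocks S | #B = d} : Finset (Finset (PG d))) := by
    ext H
    simp only [ordinaryHyperplanes, Set.mem_ofPred_eq, Set.mem_image, mem_coe, mem_filter]
    constructor
    · rintro ⟨hH, hc⟩
      have hSH : (S : Set (PG d)) ∩ H = ({x ∈ S | x ∈ H} : Finset (PG d)) := by
        ext x
        simp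
      rw [hSH, Set.ncard_coe_finset] at hc
      have hsp := hS.span_eq (filter_subset _ S) hc hH fun x hx => by simp_all
      refine ⟨_, ⟨mem_blocks.2 ⟨_, filter_subset _ S, hc, ?_⟩, hc⟩, hsp⟩
      simp only [spanSection, hsp]
    · rintro ⟨B, ⟨hB, hc⟩, rfl⟩
      obtain ⟨hBS, hBB⟩ := hmem B hB hc
      refine ⟨hS.1 B hBS hc, ?_⟩
      refine Eq.trans ?_ ((Set.ncard_coe_finset B).trans hc)
      congr 1
      ext x
      rw [Set.mem_inter_iff, mem_coe, SetLike.mem_coe, ← mem_spanSection, hBB, mem_coe]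
  rw [himage, Set.InjOn.ncard_image, Set.ncard_coe_finset, blockCount]
  intro B hB B' hB' he
  rw [mem_coe, mem_filter] at hB hB'
  rw [← (hmem B hB.1 hB.2).2, ← (hmem B' hB'.1 hB'.2).2]
  simp only [spanSection]
  simp only at he
  rw [he]

end Blocks

/-! ### Projecting an admissible set in space from one of its points -/

section Realization

variable {S : Finset (PG 3)} {p x y z : PG 3}

theorem span_rep_triple [DecidableEq (PG 3)] :
    Projectivization.Subspace.submodule
      (Projectivization.Subspace.span (({x, y, z} : Finset (PG 3)) : Set (PG 3))) =
    Submodule.span ℝ {x.rep, y.rep, z.rep} := by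
  rw [submodule_span]
  simp [Set.image_insert_eq]

theorem IsAdmissible.linearIndependent_rep (hS : IsAdmissible S) (hx : x ∈ S) (hy : y ∈ S)
    (hz : z ∈ S) (hxy : x ≠ y) (hyz : y ≠ z) (hxz : x ≠ z) :
    LinearIndependent ℝ ![x.rep, y.rep, z.rep] := by
  classical
  have h := hS.1 {x, y, z} (by simp [insert_subset_iff, *])
    (card_eq_three.2 ⟨x, y, z, hxy, hxz, hyz, rfl⟩)
  rw [IsHyperplane, span_rep_triple] at h
  rw [linearIndependent_iff_card_eq_finrank_span, Set.finrank]
  rw [Matrix.range_cons, Matrix.range_cons_cons_empty, Set.singleton_union, h, Fintype.card_fin]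

open Classical in
theorem IsAdmissible.isCombination (hS : IsAdmissible S) (hp : p ∈ S)
    (h : Collinear (derived p (blocks S)) x y z) :
    IsCombination p.rep x.rep y.rep z.rep := by
  obtain ⟨⟨hxy, hyz, hxz⟩, m, hm, hx, hy, hz⟩ := h
  obtain ⟨hpm, hm⟩ := mem_derived.1 hm
  have hmS := (hS.isWiseBalanced_blocks.1 _ hm).1
  have hxS := hmS (mem_insert_of_mem hx)
  have hyS := hmS (mem_insert_of_mem hy)
  have hzS := hmS (mem_insert_of_mem hz)
  have hpx : p ≠ x := fun e => hpm (e ▸ hx)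
  have hpy : p ≠ y := fun e => hpm (e ▸ hy)
  have hpz : p ≠ z := fun e => hpm (e ▸ hz)
  obtain ⟨T, hT, hTc, hTm⟩ := mem_blocks.1 hm
  have hT' : ∀ w ∈ insert p m, w ∈ Projectivization.Subspace.span (T : Set (PG 3)) :=
    fun w hw => (mem_spanSection.1 (hTm ▸ hw)).2
  have hsp := hS.span_eq (T := {x, y, p}) (by simp [insert_subset_iff, *])
    (card_eq_three.2 ⟨x, y, p, hxy, hpx.symm, hpy.symm, rfl⟩) (hS.1 T hT hTc) (by
      intro w hw
      simp only [coe_insert, coe_singleton, Set.mem_insert_iff, Set.mem_singleton_iff] at hw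
      refine hT' w ?_
      rcases hw with rfl | rfl | rfl <;> simp [*])
  have hz' := hT' z (mem_insert_of_mem hz)
  rw [← hsp, ← rep_mem_submodule_iff, span_rep_triple, Submodule.mem_span_triple] at hz'
  obtain ⟨r, s, t, he⟩ := hz'
  refine ⟨r, s, t, ?_, ?_, he.symm⟩
  · rintro rfl
    have := Fintype.linearIndependent_iff.1
      (hS.linearIndependent_rep hyS hp hzS hpy.symm hpz hyz) ![s, t, -1] (by
        rw [Fin.sum_univ_three]
        simp only [Matrix.cons_val, ← he]
        module) 2
    simp at this
  · rintro rfl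
    have := Fintype.linearIndependent_iff.1
      (hS.linearIndependent_rep hxS hp hzS hpx.symm hpz hxz) ![r, t, -1] (by
        rw [Fin.sum_univ_three]
        simp only [Matrix.cons_val, ← he]
        module) 2
    simp at this

open Classical in
theorem IsAdmissible.not_isMoebiusKantor (hS : IsAdmissible S) (hp : p ∈ S)
    (a b c d a' b' c' d' : PG 3) :
    ¬ IsMoebiusKantor (derived p (blocks S)) a b c d a' b' c' d' := by
  rintro ⟨h1, h2, h3, h4, h5, h6, h7, h8, hn, had, hbd⟩
  have hmem : ∀ x y z, Collinear (derived p (blocks S)) x y z → x ∈ S ∧ x ≠ p := by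
    rintro x y z ⟨-, m, hm, hx, -⟩
    obtain ⟨hpm, hm⟩ := mem_derived.1 hm
    exact ⟨(hS.isWiseBalanced_blocks.1 _ hm).1 (mem_insert_of_mem hx), fun e => hpm (e ▸ hx)⟩
  obtain ⟨haS, hap⟩ := hmem _ _ _ h1
  obtain ⟨hbS, hbp⟩ := hmem _ _ _ h3
  obtain ⟨hdS, hdp⟩ := hmem _ _ _ h2.rotate
  have hli : LinearIndependent ℝ ![a.rep, b.rep, d.rep, p.rep] := by
    refine linearIndependent_finCons.2 ⟨hS.linearIndependent_rep hbS hdS hp hbd hdp hbp,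
      fun hspan => hn ?_⟩
    have hT : ({b, d, p} : Finset (PG 3)) ⊆ S := by simp [insert_subset_iff, *]
    have hTc : #({b, d, p} : Finset (PG 3)) = 3 :=
      card_eq_three.2 ⟨b, d, p, hbd, hbp, hdp, rfl⟩
    have hB := mem_blocks.2 ⟨_, hT, hTc, rfl⟩
    have hsub := subset_spanSection hT
    have ha : a ∈ spanSection S {b, d, p} := by
      rw [mem_spanSection, ← rep_mem_submodule_iff, span_rep_triple]
      rw [Matrix.range_cons, Matrix.range_cons_cons_empty, Set.singleton_union] at hspan
      exact ⟨haS, hspan⟩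
    refine ⟨⟨h1.1.1, hbd, had⟩, _, erase_mem_derived hB (hsub (by simp)), ?_⟩
    simp only [mem_erase]
    exact ⟨⟨hap, ha⟩, ⟨hbp, hsub (by simp)⟩, hdp, hsub (by simp)⟩
  exact false_of_isCombination hli (hS.isCombination hp h1) (hS.isCombination hp h2)
    (hS.isCombination hp h3) (hS.isCombination hp h4) (hS.isCombination hp h5)
    (hS.isCombination hp h6) (hS.isCombination hp h7) (hS.isCombination hp h8)

end Realization

/-! ### Points on the twisted cubic -/

section MomentCurve

/-- The point with parameter `t` on the moment curve in `ℝ⁴`. -/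
def momentCurve (t : ℝ) : Fin 4 → ℝ := fun i => t ^ (i : ℕ)

theorem momentCurve_ne_zero (t : ℝ) : momentCurve t ≠ 0 := fun h => by
  simpa [momentCurve] using congrFun h 0

theorem linearIndepOn_momentCurve {U : Finset ℝ} (hU : #U ≤ 4) :
    LinearIndepOn ℝ momentCurve (U : Set ℝ) := by
  obtain ⟨W, hUW, hW⟩ := Infinite.exists_superset_card_eq U 4 hU
  refine LinearIndepOn.mono ?_ (coe_subset.2 hUW)
  have h := Matrix.linearIndependent_rows_of_det_ne_zero (Matrix.det_vandermonde_ne_zero_iff.2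
    (Subtype.val_injective.comp (W.equivFinOfCardEq hW).symm.injective))
  exact (linearIndependent_equiv (W.equivFinOfCardEq hW).symm).1 h

/-- The projective point with parameter `t` on the twisted cubic. -/
noncomputable def twistedCubic (t : ℝ) : PG 3 :=
  Projectivization.mk ℝ (momentCurve t) (momentCurve_ne_zero t)

theorem twistedCubic_injective : Function.Injective twistedCubic := by
  intro s t h
  obtain ⟨c, hc⟩ := (Projectivization.mk_eq_mk_iff' _ _ _ _ _).1 h
  have h0 := congrFun hc 0
  have h1 := congrFun hc 1
  simp only [momentCurve, Pi.smul_apply, smul_eq_mul, Fin.val_zero, pow_zero, mul_one,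
    Fin.val_one, pow_one] at h0 h1
  rw [h0, one_mul] at h1
  exact h1.symm

theorem finrank_span_twistedCubic {U : Finset ℝ} (hU : #U ≤ 4) :
    Module.finrank ℝ (Projectivization.Subspace.submodule
      (Projectivization.Subspace.span (twistedCubic '' (U : Set ℝ)))) = #U := by
  have h := submodule_span_image_mk (K := ℝ) momentCurve momentCurve_ne_zero (U : Set ℝ)
  change Projectivization.Subspace.submodule
    (Projectivization.Subspace.span (twistedCubic '' (U : Set ℝ))) = _ at h
  rw [h, Set.image_eq_range]
  exact (finrank_span_eq_card (linearIndepOn_momentCurve hU)).trans (by simp)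

open Classical in
theorem isAdmissible_image_twistedCubic {U : Finset ℝ} (hU : 4 ≤ #U) :
    IsAdmissible (U.image twistedCubic) := by
  constructor
  · intro T hT hc
    obtain ⟨W, hW, rfl⟩ := subset_image_iff.1 hT
    rw [card_image_of_injective _ twistedCubic_injective] at hc
    rw [IsHyperplane, coe_image, finrank_span_twistedCubic (by omega), hc]
  · rintro ⟨H, hH, hUH⟩
    obtain ⟨W, hWU, hW⟩ := exists_subset_card_eq hU
    have hle : Projectivization.Subspace.span (twistedCubic '' (W : Set ℝ)) ≤ H := by
      rw [Projectivization.Subspace.span_le_subspace_iff]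
      refine subset_trans ?_ hUH
      rw [coe_image]
      exact Set.image_mono (coe_subset.2 hWU)
    have h := Submodule.finrank_mono (Projectivization.Subspace.submodule.monotone hle)
    rw [finrank_span_twistedCubic hW.le, hH, hW] at h
    omega

end MomentCurve

end OrdinaryHyperplanes

open OrdinaryHyperplanes Finset in
theorem mainTheorem11 : 14 ≤ OrdinaryHyperplanes.e 3 9 := by
  classical
  refine le_csInf ?_ ?_
  · obtain ⟨U, hU⟩ := Infinite.exists_subset_card_eq ℝ 9
    exact ⟨_, U.image twistedCubic, by rw [card_image_of_injective _ twistedCubic_injective, hU],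
      isAdmissible_image_twistedCubic (by omega), rfl⟩
  · rintro N ⟨S, hS9, hS, rfl⟩
    rw [hS.ncard_ordinaryHyperplanes]
    exact hS.isWiseBalanced_blocks.fourteen_le_blockCount_three hS9 hS.notMem_blocks
      fun p hp => hS.not_isMoebiusKantor hp
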